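/- Let $(V,\Omega)$ be a real symplectic vector space of dimension $2n$ with a positive compatible complex structure $j$, i.e. a real linear map $j:V\to V$ with $j^2=-\mathrm{Id}$ such that $g(X,Y):=\Omega(X,jY)$ is symmetric and positive definite. Let $\mathcal N(V,\Omega,j)$ be the real vector space of bilinear maps $T:V\times V\to V$ such that, for all $X,Y,Z\in V$, $$T(X,Y)=-T(Y,X),\qquad T(jX,Y)=-jT(X,Y),$$ $$\Omega(T(X,Y),Z)+\Omega(T(Y,Z),X)+\Omega(T(Z,X),Y)=0.$$ The unitary group $U:=Sp(V,\Omega)\cap GL(V,j)$ acts on it by $(g\cdot T)(X,Y)=g\,T(g^{-1}X,g^{-1}Y)$. Let $W$ be the space $V$ viewed as a complex vector space of dimension $n$ on which $i$ acts as $j$, so that $U\subset GL(W)$; let $S^kW^*$ denote the space of symmetric tensors in $(W^*)^{\otimes k}$, with $S^3W^*\subset W^*\otimes S^2W^*$. (1) If $n\ge 2$, then $\mathcal N(V,\Omega,j)$ is an irreducible real representation of $U$: it is non-zero and its only $U$-invariant real subspaces are $0$ and itself. (If $n\le 1$, then $\mathcal N(V,\Omega,j)=0$.) (2) For every $n$ there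 is a $U$-equivariant real linear isomorphism $e:\mathcal N(V,\Omega,j)\to (W^*\otimes S^2W^*)/S^3W^*$; it satisfies $e(-j\circ T)=i\,e(T)$, i.e. it is complex linear when $i$ acts on $\mathcal N(V,\Omega,j)$ by $T\mapsto -j\circ T$. (3) If $n\ge 2$, then $(W^*\otimes S^2W^*)/S^3W^*$ is an irreducible complex representation of $GL(W)$. -/

import Mathlib

open scoped TensorProduct

noncomputable section

/-- `Ω` is a linear symplectic form: alternating and nondegenerate. -/
structure IsSymplecticForm {V : Type*} [AddCommGroup V] [Module ℝ V]
    (Ω : LinearMap.BilinForm ℝ V) : Prop where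
  alt : ∀ X, Ω X X = 0
  nondegenerate : Ω.Nondegenerate

/-- `j` is a complex structure on `V` (`j² = -1`), compatible with `Ω`
(`g(X,Y) = Ω(X, jY)` is symmetric) and positive (`g` is positive definite). -/
structure IsPositiveCompatible {V : Type*} [AddCommGroup V] [Module ℝ V]
    (Ω : LinearMap.BilinForm ℝ V) (j : V →ₗ[ℝ] V) : Prop where
  sq : ∀ X, j (j X) = -X
  symm : ∀ X Y, Ω X (j Y) = Ω Y (j X)
  pos : ∀ X, X ≠ 0 → 0 < Ω X (j X)

/-- The symplectic group `Sp(V, Ω)`. -/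
def linearSymplecticGroup {V : Type*} [AddCommGroup V] [Module ℝ V]
    (Ω : LinearMap.BilinForm ℝ V) : Subgroup (V ≃ₗ[ℝ] V) where
  carrier := {g | ∀ X Y, Ω (g X) (g Y) = Ω X Y}
  mul_mem' := by
    intro a b ha hb X Y
    simp only [LinearEquiv.mul_apply]
    rw [ha, hb]
  one_mem' := fun _ _ => rfl
  inv_mem' := by
    intro a ha X Y
    have h := ha (a⁻¹ X) (a⁻¹ Y)
    rw [← LinearEquiv.mul_apply, ← LinearEquiv.mul_apply, mul_inv_cancel] at h
    exact h.symm

/-- The group `GL(V, j)` of real linear automorphisms commuting with `j`. -/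
def complexLinearGroup {V : Type*} [AddCommGroup V] [Module ℝ V]
    (j : V →ₗ[ℝ] V) : Subgroup (V ≃ₗ[ℝ] V) where
  carrier := {g | ∀ X, g (j X) = j (g X)}
  mul_mem' := by
    intro a b ha hb X
    simp only [LinearEquiv.mul_apply]
    rw [hb, ha]
  one_mem' := fun _ => rfl
  inv_mem' := by
    intro a ha X
    apply a.injective
    rw [ha, ← LinearEquiv.mul_apply, ← LinearEquiv.mul_apply, mul_inv_cancel]
    rfl

/-- The unitary group `Sp(V, Ω) ∩ GL(V, j)`. -/
def linearUnitaryGroup {V : Type*} [AddCommGroup V] [Module ℝ V]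
    (Ω : LinearMap.BilinForm ℝ V) (j : V →ₗ[ℝ] V) : Subgroup (V ≃ₗ[ℝ] V) :=
  linearSymplecticGroup Ω ⊓ complexLinearGroup j

/-- The space `𝒩(V, Ω, j)` of `(1,2)`-tensors `T : V × V → V` with
`T(X,Y) = -T(Y,X)`, `T(jX,Y) = -j T(X,Y)` and vanishing cyclic sum of `Ω(T(X,Y),Z)`. -/
def nijenhuisSpace {V : Type*} [AddCommGroup V] [Module ℝ V]
    (Ω : LinearMap.BilinForm ℝ V) (j : V →ₗ[ℝ] V) : Submodule ℝ (V →ₗ[ℝ] V →ₗ[ℝ] V) where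
  carrier := {T | (∀ X Y, T X Y = -T Y X) ∧ (∀ X Y, T (j X) Y = -j (T X Y)) ∧
    ∀ X Y Z, Ω (T X Y) Z + Ω (T Y Z) X + Ω (T Z X) Y = 0}
  add_mem' := by
    rintro S T ⟨h1, h2, h3⟩ ⟨k1, k2, k3⟩
    refine ⟨fun X Y => ?_, fun X Y => ?_, fun X Y Z => ?_⟩
    · simp only [LinearMap.add_apply]
      rw [h1 X Y, k1 X Y]
      abel
    · simp only [LinearMap.add_apply, map_add]
      rw [h2 X Y, k2 X Y]
      abel
    · simp only [LinearMap.add_apply, map_add]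
      linear_combination h3 X Y Z + k3 X Y Z
  zero_mem' := by
    refine ⟨fun X Y => ?_, fun X Y => ?_, fun X Y Z => ?_⟩ <;> simp
  smul_mem' := by
    rintro c T ⟨h1, h2, h3⟩
    refine ⟨fun X Y => ?_, fun X Y => ?_, fun X Y Z => ?_⟩
    · simp only [LinearMap.smul_apply]
      rw [h1 X Y, smul_neg]
    · simp only [LinearMap.smul_apply, map_smul]
      rw [h2 X Y, smul_neg]
    · simp only [LinearMap.smul_apply, map_smul, smul_eq_mul]
      linear_combination c * h3 X Y Z

/-- The natural action of the unitary group on `V`. -/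
def unitaryStdRep {V : Type*} [AddCommGroup V] [Module ℝ V]
    (Ω : LinearMap.BilinForm ℝ V) (j : V →ₗ[ℝ] V) :
    Representation ℝ (linearUnitaryGroup Ω j) V :=
  (LinearEquiv.automorphismGroup.toLinearMapMonoidHom (R := ℝ) (M := V)).comp
    (linearUnitaryGroup Ω j).subtype

/-- The natural action of the unitary group on all `(1,2)`-tensors:
`(g • T)(X, Y) = g (T (g⁻¹ X, g⁻¹ Y))`. -/
def tensorRep {V : Type*} [AddCommGroup V] [Module ℝ V]
    (Ω : LinearMap.BilinForm ℝ V) (j : V →ₗ[ℝ] V) :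
    Representation ℝ (linearUnitaryGroup Ω j) (V →ₗ[ℝ] V →ₗ[ℝ] V) :=
  (unitaryStdRep Ω j).linHom ((unitaryStdRep Ω j).linHom (unitaryStdRep Ω j))

theorem tensorRep_apply {V : Type*} [AddCommGroup V] [Module ℝ V]
    (Ω : LinearMap.BilinForm ℝ V) (j : V →ₗ[ℝ] V) (g : linearUnitaryGroup Ω j)
    (T : V →ₗ[ℝ] V →ₗ[ℝ] V) (X Y : V) :
    tensorRep Ω j g T X Y = g.1 (T (g.1⁻¹ X) (g.1⁻¹ Y)) := rfl

theorem nijenhuisSpace_le_comap {V : Type*} [AddCommGroup V] [Module ℝ V]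
    (Ω : LinearMap.BilinForm ℝ V) (j : V →ₗ[ℝ] V) (g : linearUnitaryGroup Ω j) :
    nijenhuisSpace Ω j ≤ (nijenhuisSpace Ω j).comap (tensorRep Ω j g) := by
  rintro T ⟨h1, h2, h3⟩
  have hg : ∀ X, g.1 (j X) = j (g.1 X) := g.2.2
  have hg' : ∀ X, g.1⁻¹ (j X) = j (g.1⁻¹ X) := (g⁻¹).2.2
  have hΩ : ∀ X Z, Ω (g.1 X) Z = Ω X (g.1⁻¹ Z) := by
    intro X Z
    have h := g.2.1 X (g.1⁻¹ Z)
    rw [← LinearEquiv.mul_apply, mul_inv_cancel] at h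
    exact h
  refine ⟨fun X Y => ?_, fun X Y => ?_, fun X Y Z => ?_⟩
  · simp only [tensorRep_apply]
    rw [h1, map_neg]
  · simp only [tensorRep_apply]
    rw [hg', h2, map_neg, hg]
  · simp only [tensorRep_apply]
    rw [hΩ, hΩ, hΩ]
    exact h3 _ _ _

/-- The action of the unitary group on `𝒩(V, Ω, j)`. -/
def nijenhuisRep {V : Type*} [AddCommGroup V] [Module ℝ V]
    (Ω : LinearMap.BilinForm ℝ V) (j : V →ₗ[ℝ] V) :
    Representation ℝ (linearUnitaryGroup Ω j) (nijenhuisSpace Ω j) :=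
  (tensorRep Ω j).subrepresentation (nijenhuisSpace Ω j) (nijenhuisSpace_le_comap Ω j)

/-- The complex module structure on `V` defined by `j`: `(a + b i) • X = a X + b j X`. -/
abbrev complexModule {V : Type*} [AddCommGroup V] [Module ℝ V]
    (j : V →ₗ[ℝ] V) (hj : ∀ X, j (j X) = -X) : Module ℂ V where
  smul z X := z.re • X + z.im • j X
  one_smul X := by
    change (1 : ℂ).re • X + (1 : ℂ).im • j X = X
    simp
  mul_smul z w X := by
    change (z * w).re • X + (z * w).im • j X =
      z.re • (w.re • X + w.im • j X) + z.im • j (w.re • X + w.im • j X)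
    simp only [Complex.mul_re, Complex.mul_im, map_add, map_smul, hj]
    module
  smul_zero z := by
    change z.re • (0 : V) + z.im • j (0 : V) = 0
    simp
  smul_add z X Y := by
    change z.re • (X + Y) + z.im • j (X + Y) =
      (z.re • X + z.im • j X) + (z.re • Y + z.im • j Y)
    simp only [map_add]
    module
  add_smul z w X := by
    change (z + w).re • X + (z + w).im • j X =
      (z.re • X + z.im • j X) + (w.re • X + w.im • j X)
    simp only [Complex.add_re, Complex.add_im]
    module
  zero_smul X := by
    change (0 : ℂ).re • X + (0 : ℂ).im • j X = 0
    simp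

/-- The complex vector space `W`: the space `V` in which `i` acts as `j`. -/
def ComplexSpace {V : Type*} [AddCommGroup V] [Module ℝ V]
    (j : V →ₗ[ℝ] V) (_ : ∀ X, j (j X) = -X) : Type _ := V

instance ComplexSpace.instAddCommGroup {V : Type*} [AddCommGroup V] [Module ℝ V]
    (j : V →ₗ[ℝ] V) (hj : ∀ X, j (j X) = -X) : AddCommGroup (ComplexSpace j hj) :=
  inferInstanceAs (AddCommGroup V)

instance ComplexSpace.instModule {V : Type*} [AddCommGroup V] [Module ℝ V]
    (j : V →ₗ[ℝ] V) (hj : ∀ X, j (j X) = -X) : Module ℂ (ComplexSpace j hj) :=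
  @complexModule V _ _ j hj

/-- The inclusion `Sp(V, Ω) ∩ GL(V, j) → GL(W)`, which sends `g` to `g` itself. -/
def unitaryToGL {V : Type*} [AddCommGroup V] [Module ℝ V]
    (Ω : LinearMap.BilinForm ℝ V) (j : V →ₗ[ℝ] V) (hj : ∀ X, j (j X) = -X) :
    linearUnitaryGroup Ω j →* (ComplexSpace j hj ≃ₗ[ℂ] ComplexSpace j hj) where
  toFun g :=
    { toFun := fun X : V => g.1 X
      invFun := fun X : V => g.1.symm X
      left_inv := fun X : V => g.1.symm_apply_apply X
      right_inv := fun X : V => g.1.apply_symm_apply X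
      map_add' := fun X Y : V => g.1.map_add X Y
      map_smul' := fun (z : ℂ) (X : V) => by
        change g.1 (z.re • X + z.im • j X) = z.re • g.1 X + z.im • j (g.1 X)
        rw [map_add, map_smul, map_smul, g.2.2] }
  map_one' := rfl
  map_mul' _ _ := rfl

/-- `S²U ⊆ U ⊗ U`, as the space of symmetric tensors. -/
def symTwo (U : Type*) [AddCommGroup U] [Module ℂ U] : Submodule ℂ (U ⊗[ℂ] U) :=
  LinearMap.eqLocus (TensorProduct.comm ℂ U U).toLinearMap LinearMap.id

/-- The inclusion `U ⊗ S²U → U ⊗ (U ⊗ U)`. -/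
def tensorSymTwoIncl (U : Type*) [AddCommGroup U] [Module ℂ U] :
    (U ⊗[ℂ] symTwo U) →ₗ[ℂ] U ⊗[ℂ] (U ⊗[ℂ] U) :=
  (symTwo U).subtype.lTensor U

/-- `S³U` as a subspace of `U ⊗ S²U`: the tensors which, besides being symmetric in the last
two factors, are symmetric in the first two factors, hence in all three. -/
def symThree (U : Type*) [AddCommGroup U] [Module ℂ U] : Submodule ℂ (U ⊗[ℂ] symTwo U) :=
  LinearMap.eqLocus
    ((TensorProduct.leftComm ℂ U U U).toLinearMap ∘ₗ tensorSymTwoIncl U) (tensorSymTwoIncl U)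

theorem symTwo_le_comap {G U : Type*} [Group G] [AddCommGroup U] [Module ℂ U]
    (ρ : Representation ℂ G U) (g : G) :
    symTwo U ≤ (symTwo U).comap ((ρ.tprod ρ) g) := by
  intro t ht
  have ht' : TensorProduct.comm ℂ U U t = t := ht
  change TensorProduct.comm ℂ U U (TensorProduct.map (ρ g) (ρ g) t) =
    TensorProduct.map (ρ g) (ρ g) t
  rw [← TensorProduct.map_comm, ht']

/-- The representation on `S²U` induced by a representation on `U`. -/
def symTwoRep {G U : Type*} [Group G] [AddCommGroup U] [Module ℂ U]
    (ρ : Representation ℂ G U) : Representation ℂ G (symTwo U) :=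
  (ρ.tprod ρ).subrepresentation (symTwo U) (symTwo_le_comap ρ)

theorem tensorSymTwoIncl_rep {G U : Type*} [Group G] [AddCommGroup U] [Module ℂ U]
    (ρ : Representation ℂ G U) (g : G) (t : U ⊗[ℂ] symTwo U) :
    tensorSymTwoIncl U ((ρ.tprod (symTwoRep ρ)) g t) =
      TensorProduct.map (ρ g) (TensorProduct.map (ρ g) (ρ g)) (tensorSymTwoIncl U t) := by
  induction t with
  | zero => simp only [map_zero]
  | add x y hx hy => simp only [map_add, hx, hy]
  | tmul u s => rfl

theorem symThree_le_comap {G U : Type*} [Group G] [AddCommGroup U] [Module ℂ U]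
    (ρ : Representation ℂ G U) (g : G) :
    symThree U ≤ (symThree U).comap ((ρ.tprod (symTwoRep ρ)) g) := by
  intro t ht
  have ht' : TensorProduct.leftComm ℂ U U U (tensorSymTwoIncl U t) = tensorSymTwoIncl U t := ht
  have key : ∀ s : U ⊗[ℂ] (U ⊗[ℂ] U), TensorProduct.leftComm ℂ U U U
      (TensorProduct.map (ρ g) (TensorProduct.map (ρ g) (ρ g)) s) =
      TensorProduct.map (ρ g) (TensorProduct.map (ρ g) (ρ g))
        (TensorProduct.leftComm ℂ U U U s) := by
    intro s
    induction s with
    | zero => simp only [map_zero]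
    | add x y hx hy => simp only [map_add, hx, hy]
    | tmul u s =>
      induction s with
      | zero => simp only [map_zero, TensorProduct.tmul_zero]
      | add x y hx hy => simp only [map_add, TensorProduct.tmul_add, hx, hy]
      | tmul v w => rfl
  change TensorProduct.leftComm ℂ U U U
      (tensorSymTwoIncl U ((ρ.tprod (symTwoRep ρ)) g t)) =
    tensorSymTwoIncl U ((ρ.tprod (symTwoRep ρ)) g t)
  rw [tensorSymTwoIncl_rep, key, ht']

/-- The representation on `(U ⊗ S²U) / S³U` induced by a representation on `U`. -/
def hookRep {G U : Type*} [Group G] [AddCommGroup U] [Module ℂ U]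
    (ρ : Representation ℂ G U) : Representation ℂ G ((U ⊗[ℂ] symTwo U) ⧸ symThree U) :=
  (ρ.tprod (symTwoRep ρ)).quotient (symThree U) (symThree_le_comap ρ)

/-- The representation of `GL(W)` on `(W* ⊗ S²W*) / S³W*`. -/
def dualHookRep (W : Type*) [AddCommGroup W] [Module ℂ W] :
    Representation ℂ (W ≃ₗ[ℂ] W)
      ((Module.Dual ℂ W ⊗[ℂ] symTwo (Module.Dual ℂ W)) ⧸ symThree (Module.Dual ℂ W)) :=
  hookRep (Representation.dual
    (LinearEquiv.automorphismGroup.toLinearMapMonoidHom (R := ℂ) (M := W)))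

end

open scoped TensorProduct

noncomputable section

/-! Both representations are realised inside one concrete space, `hookForms W`: complex trilinear
forms on `W`, alternating in the first two arguments, with vanishing cyclic sum.

On the tensor side, view `W* ⊗ S²W*` as trilinear forms symmetric in the last two arguments and
antisymmetrize in the first two. The result satisfies the Bianchi identity, the kernel consists of
the totally symmetric forms, that is `S³W*`, and the map is onto; this gives `hookEquiv`. On the
symplectic side, `T` is conjugate linear in each argument, and so is the map `v ↦ Ω(v, ·) - i Ω(v,
j·)` from `W` to `W*`. The composite is therefore complex trilinear, and its real part `Ω(T(X,Y),Z)`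
determines it; this gives `nijenhuisFormHom`. Both maps are equivariant, so only the irreducibility
of hook forms under the unitary group remains.

Let `B` be a non-zero element of an invariant complex subspace. Some unit vector `x` has `B(x,·,x) ≠
0`, since otherwise `B` would be totally alternating and the Bianchi identity would kill it.
Averaging `B` over unitary maps that rescale only the line of `x` (`average_complexReflection`)
produces a form `(f ∧ g) ⊗ f` in the subspace, with `f`, `g` dual to an orthogonal pair.
Transitivity on orthonormal pairs gives all such forms, and polarization in `f` gives a spanning set
(`hookForms_le_of_unitary_invariant`). A real invariant subspace is automatically complex, because
the scalar `-i` is unitary and acts on cubic objects by `(-i)³ = i`. Irreducibility under `GL(W)`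
follows from that under its unitary subgroup. -/

/-- Complex trilinear forms on `W`. -/
def TrilinearForm (W : Type*) [AddCommGroup W] [Module ℂ W] : Type _ :=
  W →ₗ[ℂ] W →ₗ[ℂ] W →ₗ[ℂ] ℂ

/-! ### Trilinear forms and antisymmetrization. -/

namespace TrilinearForm

variable {W : Type*} [AddCommGroup W] [Module ℂ W]

instance : AddCommGroup (TrilinearForm W) :=
  inferInstanceAs (AddCommGroup (W →ₗ[ℂ] W →ₗ[ℂ] W →ₗ[ℂ] ℂ))

instance : Module ℂ (TrilinearForm W) :=
  inferInstanceAs (Module ℂ (W →ₗ[ℂ] W →ₗ[ℂ] W →ₗ[ℂ] ℂ))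

/-- A trilinear form as an iterated linear map. -/
def lin : TrilinearForm W ≃ₗ[ℂ] (W →ₗ[ℂ] W →ₗ[ℂ] W →ₗ[ℂ] ℂ) :=
  LinearEquiv.refl ℂ (W →ₗ[ℂ] W →ₗ[ℂ] W →ₗ[ℂ] ℂ)

/-- The value of a trilinear form. -/
def eval (B : TrilinearForm W) (x y z : W) : ℂ := lin B x y z

instance : CoeFun (TrilinearForm W) fun _ => W → W → W → ℂ := ⟨eval⟩

theorem ext {A B : TrilinearForm W} (h : ∀ x y z, A x y z = B x y z) : A = B :=
  lin.injective <| LinearMap.ext fun x => LinearMap.ext fun y => LinearMap.ext fun z => h x y z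

theorem add_apply (A B : TrilinearForm W) (x y z : W) :
    (A + B) x y z = A x y z + B x y z := rfl

theorem sub_apply (A B : TrilinearForm W) (x y z : W) :
    (A - B) x y z = A x y z - B x y z := rfl

theorem smul_apply (c : ℂ) (B : TrilinearForm W) (x y z : W) :
    (c • B) x y z = c * B x y z := rfl

theorem zero_apply (x y z : W) : (0 : TrilinearForm W) x y z = 0 := rfl

theorem eval_add₁ (B : TrilinearForm W) (x x' y z : W) :
    B (x + x') y z = B x y z + B x' y z := by
  simp only [eval, map_add, LinearMap.add_apply]

theorem eval_add₂ (B : TrilinearForm W) (x y y' z : W) :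
    B x (y + y') z = B x y z + B x y' z := by
  simp only [eval, map_add, LinearMap.add_apply]

theorem eval_add₃ (B : TrilinearForm W) (x y z z' : W) :
    B x y (z + z') = B x y z + B x y z' := by
  simp only [eval, map_add]

theorem eval_smul₁ (B : TrilinearForm W) (c : ℂ) (x y z : W) :
    B (c • x) y z = c * B x y z := by
  simp only [eval, map_smul, LinearMap.smul_apply, smul_eq_mul]

theorem eval_smul₂ (B : TrilinearForm W) (c : ℂ) (x y z : W) :
    B x (c • y) z = c * B x y z := by
  simp only [eval, map_smul, LinearMap.smul_apply, smul_eq_mul]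

theorem eval_smul₃ (B : TrilinearForm W) (c : ℂ) (x y z : W) :
    B x y (c • z) = c * B x y z := by
  simp only [eval, map_smul, smul_eq_mul]

/-- Exchange of the first two arguments. -/
def flip : TrilinearForm W →ₗ[ℂ] TrilinearForm W where
  toFun B := lin.symm (lin B).flip
  map_add' _ _ := rfl
  map_smul' _ _ := rfl

theorem flip_apply (B : TrilinearForm W) (x y z : W) : flip B x y z = B y x z := rfl

/-- Antisymmetrization in the first two arguments. -/
def skew : TrilinearForm W →ₗ[ℂ] TrilinearForm W := LinearMap.id - flip

theorem skew_apply (B : TrilinearForm W) (x y z : W) :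
    skew B x y z = B x y z - B y x z := by
  rw [← flip_apply B x y z, ← sub_apply]
  rfl

end TrilinearForm

/-! ### Hook forms as a model of `(W* ⊗ S²W*) / S³W*`. -/

open TrilinearForm (skew)

/-- The trilinear forms that are alternating in the first two arguments and satisfy the
Bianchi identity. -/
def hookForms (W : Type*) [AddCommGroup W] [Module ℂ W] : Submodule ℂ (TrilinearForm W) where
  carrier := {B | (∀ x y z, B x y z = -B y x z) ∧
    ∀ x y z, B x y z + B y z x + B z x y = 0}
  add_mem' := by
    rintro A B ⟨h1, h2⟩ ⟨k1, k2⟩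
    refine ⟨fun x y z => ?_, fun x y z => ?_⟩
    · simp only [TrilinearForm.add_apply]
      linear_combination h1 x y z + k1 x y z
    · simp only [TrilinearForm.add_apply]
      linear_combination h2 x y z + k2 x y z
  zero_mem' := by
    refine ⟨fun x y z => ?_, fun x y z => ?_⟩ <;> simp only [TrilinearForm.zero_apply] <;> ring
  smul_mem' := by
    rintro c B ⟨h1, h2⟩
    refine ⟨fun x y z => ?_, fun x y z => ?_⟩
    · simp only [TrilinearForm.smul_apply]
      linear_combination c * h1 x y z
    · simp only [TrilinearForm.smul_apply]
      linear_combination c * h2 x y z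

section TensorModel

variable {W : Type*} [AddCommGroup W] [Module ℂ W]

/-- The symmetrization map `U ⊗ U → S²U`, `u ⊗ v ↦ u ⊗ v + v ⊗ u`. -/
def symmetrize (U : Type*) [AddCommGroup U] [Module ℂ U] : (U ⊗[ℂ] U) →ₗ[ℂ] symTwo U :=
  LinearMap.codRestrict (symTwo U) (LinearMap.id + (TensorProduct.comm ℂ U U).toLinearMap)
    fun t => by
      change TensorProduct.comm ℂ U U (t + TensorProduct.comm ℂ U U t) =
        t + TensorProduct.comm ℂ U U t
      rw [map_add, TensorProduct.comm_comm, add_comm]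

theorem coe_symmetrize {U : Type*} [AddCommGroup U] [Module ℂ U] (t : U ⊗[ℂ] U) :
    (symmetrize U t : U ⊗[ℂ] U) = t + TensorProduct.comm ℂ U U t := rfl

theorem tensorSymTwoIncl_tmul {U : Type*} [AddCommGroup U] [Module ℂ U] (u : U) (s : symTwo U) :
    tensorSymTwoIncl U (u ⊗ₜ s) = u ⊗ₜ (s : U ⊗[ℂ] U) := rfl

/-- The isomorphism from `(U ⊗ S²U) / S³U` induced by a surjection with kernel `S³U`. -/
def quotientSymThreeEquiv (U : Type*) [AddCommGroup U] [Module ℂ U] {N : Type*} [AddCommGroup N]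
    [Module ℂ N] (φ : (U ⊗[ℂ] symTwo U) →ₗ[ℂ] N) (hker : LinearMap.ker φ = symThree U)
    (hφ : Function.Surjective φ) : ((U ⊗[ℂ] symTwo U) ⧸ symThree U) ≃ₗ[ℂ] N :=
  Submodule.quotEquivOfEq _ _ hker.symm ≪≫ₗ φ.quotKerEquivOfSurjective hφ

theorem quotientSymThreeEquiv_mk (U : Type*) [AddCommGroup U] [Module ℂ U] {N : Type*}
    [AddCommGroup N] [Module ℂ N] (φ : (U ⊗[ℂ] symTwo U) →ₗ[ℂ] N)
    (hker : LinearMap.ker φ = symThree U) (hφ : Function.Surjective φ) (t : U ⊗[ℂ] symTwo U) :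
    quotientSymThreeEquiv U φ hker hφ ((symThree U).mkQ t) = φ t := rfl

variable [FiniteDimensional ℂ W]

/-- Three-fold tensors on the dual are trilinear forms. -/
def tensorDualEquiv : (Module.Dual ℂ W ⊗[ℂ] (Module.Dual ℂ W ⊗[ℂ] Module.Dual ℂ W)) ≃ₗ[ℂ]
    TrilinearForm W :=
  LinearEquiv.ofBijective (dualTensorHom ℂ W _) dualTensorHom_bijective ≪≫ₗ
    LinearEquiv.congrRight
      (LinearEquiv.ofBijective (dualTensorHom ℂ W _) dualTensorHom_bijective) ≪≫ₗ
    TrilinearForm.lin.symm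

theorem tensorDualEquiv_tmul (f g h : Module.Dual ℂ W) (x y z : W) :
    tensorDualEquiv (f ⊗ₜ (g ⊗ₜ h)) x y z = f x * (g y * h z) := by
  change dualTensorHom ℂ W (W →ₗ[ℂ] ℂ) (f x • (g ⊗ₜ h)) y z = _
  rw [map_smul, LinearMap.smul_apply, dualTensorHom_apply, LinearMap.smul_apply,
    LinearMap.smul_apply, smul_eq_mul, smul_eq_mul]

/-- Induction on three-fold tensors. -/
theorem tensor_three_induction {U : Type*} [AddCommGroup U] [Module ℂ U]
    {p : U ⊗[ℂ] (U ⊗[ℂ] U) → Prop} (zero : p 0) (add : ∀ s t, p s → p t → p (s + t))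
    (tmul : ∀ f g h, p (f ⊗ₜ (g ⊗ₜ h))) (t : U ⊗[ℂ] (U ⊗[ℂ] U)) : p t := by
  induction t with
  | zero => exact zero
  | add s t hs ht => exact add _ _ hs ht
  | tmul f s =>
    induction s with
    | zero => rw [TensorProduct.tmul_zero]; exact zero
    | add s t hs ht => rw [TensorProduct.tmul_add]; exact add _ _ hs ht
    | tmul g h => exact tmul f g h

theorem tensorDualEquiv_leftComm
    (t : Module.Dual ℂ W ⊗[ℂ] (Module.Dual ℂ W ⊗[ℂ] Module.Dual ℂ W)) (x y z : W) :
    tensorDualEquiv (TensorProduct.leftComm ℂ _ _ _ t) x y z = tensorDualEquiv t y x z := by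
  induction t using tensor_three_induction with
  | zero => simp only [map_zero, TrilinearForm.zero_apply]
  | add s t hs ht => simp only [map_add, TrilinearForm.add_apply, hs, ht]
  | tmul f g h =>
    rw [TensorProduct.leftComm_tmul, tensorDualEquiv_tmul, tensorDualEquiv_tmul]
    ring

theorem tensorDualEquiv_incl_symmetrize
    (t : Module.Dual ℂ W ⊗[ℂ] (Module.Dual ℂ W ⊗[ℂ] Module.Dual ℂ W)) (x y z : W) :
    tensorDualEquiv (tensorSymTwoIncl _ ((symmetrize _).lTensor _ t)) x y z =
      tensorDualEquiv t x y z + tensorDualEquiv t x z y := by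
  induction t using tensor_three_induction with
  | zero => simp only [map_zero, TrilinearForm.zero_apply, add_zero]
  | add s t hs ht =>
    simp only [map_add, TrilinearForm.add_apply, hs, ht]
    ring
  | tmul f g h =>
    rw [LinearMap.lTensor_tmul, tensorSymTwoIncl_tmul, coe_symmetrize, TensorProduct.comm_tmul,
      TensorProduct.tmul_add, map_add, TrilinearForm.add_apply, tensorDualEquiv_tmul, tensorDualEquiv_tmul, tensorDualEquiv_tmul,
      mul_comm (h y)]

theorem tensorDualEquiv_incl_swap
    (t : Module.Dual ℂ W ⊗[ℂ] symTwo (Module.Dual ℂ W)) (x y z : W) :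
    tensorDualEquiv (tensorSymTwoIncl _ t) x y z =
      tensorDualEquiv (tensorSymTwoIncl _ t) x z y := by
  induction t with
  | zero => simp only [map_zero, TrilinearForm.zero_apply]
  | add s t hs ht => simp only [map_add, TrilinearForm.add_apply, hs, ht]
  | tmul f s =>
    have key : ∀ r : Module.Dual ℂ W ⊗[ℂ] Module.Dual ℂ W,
        tensorDualEquiv (f ⊗ₜ TensorProduct.comm ℂ _ _ r) x y z =
          tensorDualEquiv (f ⊗ₜ r) x z y := by
      intro r
      induction r with
      | zero => simp only [map_zero, TensorProduct.tmul_zero, TrilinearForm.zero_apply]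
      | add s t hs ht =>
        simp only [map_add, TensorProduct.tmul_add, TrilinearForm.add_apply, hs, ht]
      | tmul g h =>
        rw [TensorProduct.comm_tmul, tensorDualEquiv_tmul, tensorDualEquiv_tmul]
        ring
    have hs : TensorProduct.comm ℂ _ _ s.1 = s.1 := s.2
    have h := key s.1
    rw [hs] at h
    exact h

/-- The map `W* ⊗ S²W* → hookForms W`, antisymmetrizing in the first two arguments. -/
def hookMap : (Module.Dual ℂ W ⊗[ℂ] symTwo (Module.Dual ℂ W)) →ₗ[ℂ] hookForms W :=
  LinearMap.codRestrict (hookForms W)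
    (skew ∘ₗ tensorDualEquiv.toLinearMap ∘ₗ tensorSymTwoIncl _) fun t => by
      have h := tensorDualEquiv_incl_swap t
      refine ⟨fun x y z => ?_, fun x y z => ?_⟩
      · change skew _ x y z = -skew _ y x z
        rw [TrilinearForm.skew_apply, TrilinearForm.skew_apply]
        ring
      · change skew _ x y z + skew _ y z x + skew _ z x y = 0
        simp only [TrilinearForm.skew_apply, LinearMap.comp_apply, LinearEquiv.coe_coe]
        linear_combination h x y z + h y z x + h z x y

theorem hookMap_apply (t : Module.Dual ℂ W ⊗[ℂ] symTwo (Module.Dual ℂ W)) (x y z : W) :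
    (hookMap t).1 x y z = tensorDualEquiv (tensorSymTwoIncl _ t) x y z -
      tensorDualEquiv (tensorSymTwoIncl _ t) y x z := rfl

/-- Under `tensorDualEquiv`, `leftComm` becomes the exchange of the first two arguments, so being
fixed by it means having zero antisymmetrization. -/
theorem ker_hookMap : LinearMap.ker (hookMap (W := W)) = symThree (Module.Dual ℂ W) := by
  ext t
  have h3 : t ∈ symThree (Module.Dual ℂ W) ↔
      TensorProduct.leftComm ℂ _ _ _ (tensorSymTwoIncl _ t) = tensorSymTwoIncl _ t := Iff.rfl
  rw [LinearMap.mem_ker, h3]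
  constructor
  · intro h
    apply tensorDualEquiv.injective
    refine TrilinearForm.ext fun x y z => ?_
    rw [tensorDualEquiv_leftComm]
    have h' : (hookMap t).1 x y z = 0 := by rw [h]; rfl
    rw [hookMap_apply] at h'
    linear_combination -h'
  · intro h
    refine Subtype.ext (TrilinearForm.ext fun x y z => ?_)
    rw [hookMap_apply]
    nth_rewrite 2 [← h]
    rw [tensorDualEquiv_leftComm, sub_self]
    rfl

/-- More precise than surjectivity of `hookMap`: the preimage is a symmetrized tensor. Hence the
images of the elements `f ⊗ (g ⊗ h + h ⊗ g)` span the hook forms, which the irreducibility proof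
uses. -/
theorem exists_hookMap_symmetrize_eq (B : hookForms W) :
    ∃ t, hookMap ((symmetrize _).lTensor (Module.Dual ℂ W) t) = B := by
  -- Symmetrizing `B` in the last two arguments (without a factor 1/2) and then antisymmetrizing in
  -- the first two gives `2 B(x,y,z) - B(y,z,x) - B(z,x,y)`, which is `3 B(x,y,z)` by the Bianchi
  -- identity.
  refine ⟨tensorDualEquiv.symm ((3 : ℂ)⁻¹ • B.1),
    Subtype.ext (TrilinearForm.ext fun x y z => ?_)⟩
  rw [hookMap_apply, tensorDualEquiv_incl_symmetrize, tensorDualEquiv_incl_symmetrize,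
    LinearEquiv.apply_symm_apply]
  simp only [TrilinearForm.smul_apply]
  linear_combination (3 : ℂ)⁻¹ * (- B.2.1 y x z + B.2.1 x z y - B.2.2 x y z)

theorem hookMap_surjective : Function.Surjective (hookMap (W := W)) := fun B =>
  (exists_hookMap_symmetrize_eq B).elim fun _ ht => ⟨_, ht⟩

/-- `(W* ⊗ S²W*) / S³W*` is the space of hook forms. -/
def hookEquiv : ((Module.Dual ℂ W ⊗[ℂ] symTwo (Module.Dual ℂ W)) ⧸ symThree (Module.Dual ℂ W))
    ≃ₗ[ℂ] hookForms W :=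
  quotientSymThreeEquiv (N := hookForms W) (Module.Dual ℂ W) (hookMap (W := W))
    (ker_hookMap (W := W)) (hookMap_surjective (W := W))

theorem hookEquiv_mk (t : Module.Dual ℂ W ⊗[ℂ] symTwo (Module.Dual ℂ W)) :
    hookEquiv ((symThree (Module.Dual ℂ W)).mkQ t) = hookMap t :=
  quotientSymThreeEquiv_mk (N := hookForms W) (Module.Dual ℂ W) (hookMap (W := W))
    (ker_hookMap (W := W)) (hookMap_surjective (W := W)) t

/-- Equivariance of the tensor model, reduced to pure tensors, on which the dual action is
composition with `g⁻¹`. -/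
theorem hookEquiv_dualHookRep (g : W ≃ₗ[ℂ] W)
    (q : (Module.Dual ℂ W ⊗[ℂ] symTwo (Module.Dual ℂ W)) ⧸ symThree (Module.Dual ℂ W))
    (x y z : W) :
    (hookEquiv (dualHookRep W g q)).1 x y z =
      (hookEquiv q).1 (g⁻¹ x) (g⁻¹ y) (g⁻¹ z) := by
  obtain ⟨t, rfl⟩ := Submodule.mkQ_surjective _ q
  set ρ : Representation ℂ (W ≃ₗ[ℂ] W) (Module.Dual ℂ W) := Representation.dual
    (LinearEquiv.automorphismGroup.toLinearMapMonoidHom (R := ℂ) (M := W)) with hρ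
  have key : ∀ (s : Module.Dual ℂ W ⊗[ℂ] (Module.Dual ℂ W ⊗[ℂ] Module.Dual ℂ W)) (x y z : W),
      tensorDualEquiv (TensorProduct.map (ρ g) (TensorProduct.map (ρ g) (ρ g)) s) x y z =
        tensorDualEquiv s (g⁻¹ x) (g⁻¹ y) (g⁻¹ z) := by
    intro s x y z
    induction s using tensor_three_induction with
    | zero => simp only [map_zero, TrilinearForm.zero_apply]
    | add s t hs ht => simp only [map_add, TrilinearForm.add_apply, hs, ht]
    | tmul f g' h =>
      rw [TensorProduct.map_tmul, TensorProduct.map_tmul, tensorDualEquiv_tmul,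
        tensorDualEquiv_tmul]
      rfl
  have hmk : dualHookRep W g ((symThree (Module.Dual ℂ W)).mkQ t) =
      (symThree (Module.Dual ℂ W)).mkQ ((ρ.tprod (symTwoRep ρ)) g t) := rfl
  rw [hmk, hookEquiv_mk, hookEquiv_mk, hookMap_apply, hookMap_apply, tensorSymTwoIncl_rep, key, key]

end TensorModel

/-! ### Decomposable hook forms and averaging over complex reflections. -/

namespace TrilinearForm

section Algebra

variable {W : Type*} [AddCommGroup W] [Module ℂ W]

/-- The pullback of a trilinear form by a linear map. -/
def pullback (B : TrilinearForm W) (g : W →ₗ[ℂ] W) : TrilinearForm W :=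
  lin.symm (((lin B).compl₁₂ g g).compr₂ (LinearMap.lcomp ℂ ℂ g))

theorem pullback_apply (B : TrilinearForm W) (g : W →ₗ[ℂ] W) (x y z : W) :
    pullback B g x y z = B (g x) (g y) (g z) := rfl

/-- The trilinear form `(f ∧ g) ⊗ h`. -/
def wedgeTensor (f g h : Module.Dual ℂ W) : TrilinearForm W :=
  skew (lin.symm (f.smulRight (g.smulRight h)))

theorem wedgeTensor_apply (f g h : Module.Dual ℂ W) (x y z : W) :
    wedgeTensor f g h x y z = (f x * g y - f y * g x) * h z := by
  have : ∀ x y, (lin.symm (f.smulRight (g.smulRight h)) : TrilinearForm W) x y z =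
      f x * (g y * h z) := fun _ _ => rfl
  rw [wedgeTensor, skew_apply, this, this]
  ring

/-- A form satisfying the Bianchi identity vanishes as soon as `B(x, y, x) = 0`. -/
theorem eq_zero_of_eval_self {B : TrilinearForm W} (hB : B ∈ hookForms W)
    (h : ∀ x y, B x y x = 0) : B = 0 := by
  refine ext fun x y z => ?_
  -- Polarizing the hypothesis makes `B` alternating in the outer arguments too. It is then totally
  -- alternating, hence invariant under cyclic permutations, and its cyclic sum is `3 B`.
  have h13 : ∀ x y z, B x y z = -B z y x := fun x y z => by
    have := h (x + z) y
    rw [eval_add₁, eval_add₃, eval_add₃, h, h] at this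
    linear_combination this
  rw [zero_apply]
  linear_combination (1 / 3 : ℂ) * (hB.2 x y z + 2 * (hB.1 x y z - h13 z x y) - h13 y z x +
    hB.1 x z y)

end Algebra

section Hermitian

variable {W : Type*} [NormedAddCommGroup W] [InnerProductSpace ℂ W]

local notation "⟪" x ", " y "⟫" => inner ℂ x y

/-- The linear functional `⟪x, ·⟫`. -/
def innerDual (x : W) : Module.Dual ℂ W := innerₛₗ ℂ x

theorem innerDual_apply (x y : W) : innerDual x y = ⟪x, y⟫ := rfl

/-- The complex reflection that multiplies the unit vector `x` by `a`. -/
def complexReflection (x : W) (a : ℂ) : W →ₗ[ℂ] W :=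
  LinearMap.id + (a - 1) • (innerDual x).smulRight x

theorem complexReflection_apply (x : W) (a : ℂ) (u : W) :
    complexReflection x a u = u + ((a - 1) * ⟪x, u⟫) • x := by
  rw [mul_smul]
  rfl

theorem inner_complexReflection {x : W} (hx : ‖x‖ = 1) {a : ℂ} (ha : starRingEnd ℂ a * a = 1)
    (u v : W) : ⟪complexReflection x a u, complexReflection x a v⟫ = ⟪u, v⟫ := by
  have hxx : ⟪x, x⟫ = (1 : ℂ) := by simp [inner_self_eq_norm_sq_to_K, hx]
  simp only [complexReflection_apply, inner_add_left, inner_add_right, inner_smul_left,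
    inner_smul_right, map_mul, map_sub, map_one, inner_conj_symm, hxx]
  linear_combination ⟪u, x⟫ * ⟪x, v⟫ * ha

/-- Averaging over the fourth roots of unity acting on the line of `x` extracts the part of
degree two in `x`. -/
theorem average_complexReflection {B : TrilinearForm W} (hB : B ∈ hookForms W) (x : W) :
    (1 / 4 : ℂ) • (pullback B (complexReflection x 1) - pullback B (complexReflection x Complex.I)
      + pullback B (complexReflection x (-1)) - pullback B (complexReflection x (-Complex.I))) =
    wedgeTensor (innerDual x) ((lin B x).flip x) (innerDual x) := by
  -- The pullback is a polynomial in `a` of degree at most 3, and the signs 1, -1, 1, -1 are the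
  -- values of `a⁻²` at the fourth roots of unity, so the average is the coefficient of `a²`. Since
  -- `B(x,x,·) = 0`, only the terms with `x` in the last slot and in one of the first two survive.
  refine ext fun u v w => ?_
  have h1 : ∀ w, B x x w = 0 := fun w => by linear_combination (1 / 2 : ℂ) * hB.1 x x w
  have h2 : ∀ u, B u x x = -B x u x := fun u => hB.1 u x x
  have h3 : ∀ v, (lin B x).flip x v = B x v x := fun _ => rfl
  simp only [smul_apply, add_apply, sub_apply, pullback_apply, complexReflection_apply,
    wedgeTensor_apply, eval_add₁, eval_add₂, eval_add₃, eval_smul₁, eval_smul₂, eval_smul₃,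
    h1, h2, h3, innerDual_apply]
  ring_nf
  simp only [Complex.I_sq]
  ring

end Hermitian

end TrilinearForm

/-! ### Irreducibility of hook forms under the unitary group. -/

namespace TrilinearForm

section Hermitian

variable {W : Type*} [NormedAddCommGroup W] [InnerProductSpace ℂ W]

local notation "⟪" x ", " y "⟫" => inner ℂ x y

theorem orthonormal_restrict_pair {ι : Type*} [DecidableEq ι] {a b : ι} (hab : a ≠ b) {p q : W}
    (hp : ‖p‖ = 1) (hq : ‖q‖ = 1) (hpq : ⟪p, q⟫ = (0 : ℂ)) :
    Orthonormal ℂ (({a, b} : Set ι).domRestrict fun i => if i = a then p else q) := by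
  have hqp : ⟪q, p⟫ = (0 : ℂ) := inner_eq_zero_symm.1 hpq
  constructor
  · rintro ⟨i, rfl | rfl⟩
    · simpa using hp
    · simpa [hab.symm] using hq
  · rintro ⟨i, rfl | rfl⟩ ⟨k, rfl | rfl⟩ hik
    · exact absurd rfl hik
    · simpa [hab.symm] using hpq
    · simpa [hab.symm] using hqp
    · exact absurd rfl hik

/-- The unitary group acts transitively on orthonormal pairs. -/
theorem exists_linearIsometryEquiv_pair [FiniteDimensional ℂ W] {p q x z : W}
    (hp : ‖p‖ = 1) (hq : ‖q‖ = 1) (hpq : ⟪p, q⟫ = (0 : ℂ))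
    (hx : ‖x‖ = 1) (hz : ‖z‖ = 1) (hxz : ⟪x, z⟫ = (0 : ℂ)) :
    ∃ g : W ≃ₗᵢ[ℂ] W, g p = x ∧ g q = z := by
  -- An orthonormal pair forces dimension at least 2, so the basis can be indexed by `Fin (k + 2)`
  -- and the pairs placed at the indices 0 and 1.
  have hcard : 2 ≤ Module.finrank ℂ W := by
    have h := (orthonormal_restrict_pair (ι := Bool) Bool.false_ne_true hp hq
      hpq).linearIndependent.fintype_card_le_finrank
    simpa using h
  obtain ⟨k, hk⟩ := Nat.exists_eq_add_of_le' hcard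
  have h01 : (0 : Fin (k + 2)) ≠ 1 := by simp
  have hc : Module.finrank ℂ W = Fintype.card (Fin (k + 2)) := by simpa using hk
  obtain ⟨b, hb⟩ := (orthonormal_restrict_pair h01 hp hq
    hpq).exists_orthonormalBasis_extension_of_card_eq hc
  obtain ⟨b', hb'⟩ := (orthonormal_restrict_pair h01 hx hz
    hxz).exists_orthonormalBasis_extension_of_card_eq hc
  refine ⟨b.equiv b' (Equiv.refl _), ?_, ?_⟩
  · have h := hb 0 (by simp)
    have h' := hb' 0 (by simp)
    simp only [if_true] at h h'
    rw [← h, ← h', OrthonormalBasis.equiv_apply_basis, Equiv.refl_apply]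
  · have h := hb 1 (by simp)
    have h' := hb' 1 (by simp)
    simp only [if_neg h01.symm] at h h'
    rw [← h, ← h', OrthonormalBasis.equiv_apply_basis, Equiv.refl_apply]

theorem innerDual_surjective [FiniteDimensional ℂ W] :
    Function.Surjective (innerDual : W → Module.Dual ℂ W) := by
  intro f
  refine ⟨(InnerProductSpace.toDual ℂ W).symm (LinearMap.toContinuousLinearMap f), ?_⟩
  ext u
  rw [innerDual_apply, InnerProductSpace.toDual_symm_apply]
  rfl

/-- A vector is a multiple of a unit vector. -/
theorem exists_eq_smul_unit {p : W} (hp : p ≠ 0) :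
    ∃ (c : ℂ) (u : W), c ≠ 0 ∧ ‖u‖ = 1 ∧ p = c • u :=
  ⟨(‖p‖ : ℂ), (‖p‖ : ℂ)⁻¹ • p, by simpa using hp, norm_smul_inv_norm hp,
    (smul_inv_smul₀ (by simpa using hp) p).symm⟩

theorem wedgeTensor_pullback {g : W →ₗ[ℂ] W} (hg : ∀ u v, ⟪g u, g v⟫ = ⟪u, v⟫) (p q : W) :
    pullback (wedgeTensor (innerDual (g p)) (innerDual (g q)) (innerDual (g p))) g =
      wedgeTensor (innerDual p) (innerDual q) (innerDual p) := by
  refine ext fun u v w => ?_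
  simp only [pullback_apply, wedgeTensor_apply, innerDual_apply, hg]

variable [FiniteDimensional ℂ W] {M : Submodule ℂ (TrilinearForm W)}

/-- Starting from a non-zero form in `M`, averaging over complex reflections isolates a decomposable
one. Its second factor is `B(x,·,x)`, whose Riesz vector is orthogonal to `x` because `B(x,x,x) =
0`. -/
theorem exists_orthonormal_wedgeTensor_mem (hM : M ≤ hookForms W)
    (hinv : ∀ g : W →ₗ[ℂ] W, (∀ u v, ⟪g u, g v⟫ = ⟪u, v⟫) → ∀ B ∈ M, pullback B g ∈ M)
    (hne : M ≠ ⊥) : ∃ x z : W, ‖x‖ = 1 ∧ ‖z‖ = 1 ∧ ⟪x, z⟫ = (0 : ℂ) ∧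
      wedgeTensor (innerDual x) (innerDual z) (innerDual x) ∈ M := by
  obtain ⟨B, hBM, hB0⟩ := M.ne_bot_iff.1 hne
  have hB := hM hBM
  obtain ⟨p, y, hpy⟩ : ∃ p y, B p y p ≠ 0 := by
    by_contra! h
    exact hB0 (eq_zero_of_eval_self hB h)
  have hp : p ≠ 0 := by
    rintro rfl
    apply hpy
    rw [← zero_smul ℂ (0 : W), eval_smul₁, zero_mul]
  obtain ⟨c, x, hc, hx, rfl⟩ := exists_eq_smul_unit hp
  have hxy : B x y x ≠ 0 := by
    intro h
    rw [eval_smul₁, eval_smul₃, h] at hpy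
    simp at hpy
  obtain ⟨z, hz⟩ := innerDual_surjective ((lin B x).flip x)
  have hzv : ∀ v, ⟪z, v⟫ = B x v x := fun v => by rw [← innerDual_apply, hz]; rfl
  have hzx : ⟪z, x⟫ = (0 : ℂ) := by
    rw [hzv]
    linear_combination (1 / 2 : ℂ) * hB.1 x x x
  have hz0 : z ≠ 0 := by
    rintro rfl
    apply hxy
    rw [← hzv, inner_zero_left]
  have hmem : wedgeTensor (innerDual x) (innerDual z) (innerDual x) ∈ M := by
    rw [hz, ← average_complexReflection hB]
    have h : ∀ a : ℂ, starRingEnd ℂ a * a = 1 → pullback B (complexReflection x a) ∈ M :=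
      fun a ha => hinv _ (inner_complexReflection hx ha) B hBM
    refine M.smul_mem _ (M.sub_mem (M.add_mem (M.sub_mem (h _ ?_) (h _ ?_)) (h _ ?_)) (h _ ?_)) <;>
      simp
  obtain ⟨d, e, hd, he, rfl⟩ := exists_eq_smul_unit hz0
  rw [inner_smul_left, mul_eq_zero] at hzx
  have hd' : starRingEnd ℂ d ≠ 0 := by simpa using hd
  refine ⟨x, e, hx, he, inner_eq_zero_symm.1 (hzx.resolve_left hd'), ?_⟩
  have heq : wedgeTensor (innerDual x) (innerDual e) (innerDual x) = (starRingEnd ℂ d)⁻¹ •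
      wedgeTensor (innerDual x) (innerDual (d • e)) (innerDual x) := by
    refine ext fun u v w => ?_
    simp only [smul_apply, wedgeTensor_apply, innerDual_apply, inner_smul_left]
    field_simp
  rw [heq]
  exact M.smul_mem _ hmem

/-- Transitivity on orthonormal pairs spreads the single element found above to all such pairs. The
general case reduces to this one by Gram–Schmidt and rescaling. -/
theorem wedgeTensor_mem (hM : M ≤ hookForms W)
    (hinv : ∀ g : W →ₗ[ℂ] W, (∀ u v, ⟪g u, g v⟫ = ⟪u, v⟫) → ∀ B ∈ M, pullback B g ∈ M)
    (hne : M ≠ ⊥) (f g : Module.Dual ℂ W) : wedgeTensor f g f ∈ M := by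
  obtain ⟨x, z, hx, hz, hxz, hmem⟩ := exists_orthonormal_wedgeTensor_mem hM hinv hne
  have horth : ∀ p q : W, ‖p‖ = 1 → ‖q‖ = 1 → ⟪p, q⟫ = (0 : ℂ) →
      wedgeTensor (innerDual p) (innerDual q) (innerDual p) ∈ M := by
    intro p q hp hq hpq
    obtain ⟨g, rfl, rfl⟩ := exists_linearIsometryEquiv_pair hp hq hpq hx hz hxz
    have hg : ∀ u v, ⟪g.toLinearMap u, g.toLinearMap v⟫ = ⟪u, v⟫ := g.inner_map_map
    have h := hinv g.toLinearMap hg _ hmem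
    rwa [show (g p) = g.toLinearMap p from rfl, show (g q) = g.toLinearMap q from rfl,
      wedgeTensor_pullback hg] at h
  obtain ⟨p, rfl⟩ := innerDual_surjective f
  obtain ⟨q, rfl⟩ := innerDual_surjective g
  by_cases hp : p = 0
  · have : wedgeTensor (innerDual p) (innerDual q) (innerDual p) = 0 := by
      refine ext fun u v w => ?_
      simp [wedgeTensor_apply, innerDual_apply, hp, zero_apply]
    rw [this]
    exact M.zero_mem
  obtain ⟨c, x, -, hx, rfl⟩ := exists_eq_smul_unit hp
  have hxx : ⟪x, x⟫ = (1 : ℂ) := by simp [inner_self_eq_norm_sq_to_K, hx]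
  -- Replacing `q` by its component orthogonal to `x` is harmless: the wedge product with the
  -- functional of `x` kills the rest.
  set r := q - (⟪x, q⟫ : ℂ) • x with hr
  have hxr : ⟪x, r⟫ = (0 : ℂ) := by rw [hr, inner_sub_right, inner_smul_right, hxx]; ring
  have hred : wedgeTensor (innerDual (c • x)) (innerDual q) (innerDual (c • x)) =
      (starRingEnd ℂ c * starRingEnd ℂ c) •
        wedgeTensor (innerDual x) (innerDual r) (innerDual x) := by
    refine ext fun u v w => ?_
    simp only [smul_apply, wedgeTensor_apply, innerDual_apply, inner_smul_left, hr,
      inner_sub_left]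
    ring
  rw [hred]
  refine M.smul_mem _ ?_
  by_cases hr0 : r = 0
  · have : wedgeTensor (innerDual x) (innerDual r) (innerDual x) = 0 := by
      refine ext fun u v w => ?_
      simp [wedgeTensor_apply, innerDual_apply, hr0, zero_apply]
    rw [this]
    exact M.zero_mem
  obtain ⟨d, e, hd, he, hde⟩ := exists_eq_smul_unit hr0
  have hxe : ⟪x, e⟫ = (0 : ℂ) := by
    rw [hde, inner_smul_right, mul_eq_zero] at hxr
    exact hxr.resolve_left hd
  have heq : wedgeTensor (innerDual x) (innerDual r) (innerDual x) = starRingEnd ℂ d •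
      wedgeTensor (innerDual x) (innerDual e) (innerDual x) := by
    refine ext fun u v w => ?_
    simp only [smul_apply, wedgeTensor_apply, innerDual_apply, inner_smul_left, hde]
    ring
  rw [heq]
  exact M.smul_mem _ (horth x e hx he hxe)

/-- A nonzero unitarily invariant space of hook forms contains all hook forms. -/
theorem hookForms_le_of_unitary_invariant (hM : M ≤ hookForms W)
    (hinv : ∀ g : W →ₗ[ℂ] W, (∀ u v, ⟪g u, g v⟫ = ⟪u, v⟫) → ∀ B ∈ M, pullback B g ∈ M)
    (hne : M ≠ ⊥) : hookForms W ≤ M := by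
  -- Polarization of the quadratic dependence on `f` in `(f ∧ g) ⊗ f`.
  have hpol : ∀ f g h : Module.Dual ℂ W, wedgeTensor f g h + wedgeTensor h g f ∈ M := by
    intro f g h
    have heq : wedgeTensor f g h + wedgeTensor h g f =
        wedgeTensor (f + h) g (f + h) - wedgeTensor f g f - wedgeTensor h g h := by
      refine ext fun u v w => ?_
      simp only [add_apply, sub_apply, wedgeTensor_apply, LinearMap.add_apply]
      ring
    rw [heq]
    exact M.sub_mem (M.sub_mem (wedgeTensor_mem hM hinv hne _ _)
      (wedgeTensor_mem hM hinv hne _ _)) (wedgeTensor_mem hM hinv hne _ _)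
  intro B hB
  obtain ⟨t, ht⟩ := exists_hookMap_symmetrize_eq ⟨B, hB⟩
  have key : ∀ t, (hookMap ((symmetrize _).lTensor (Module.Dual ℂ W) t)).1 ∈ M := by
    intro t
    induction t using tensor_three_induction with
    | zero => rw [map_zero, map_zero]; exact M.zero_mem
    | add s t hs ht => rw [map_add, map_add]; exact M.add_mem hs ht
    | tmul f g h =>
      have heq : (hookMap ((symmetrize _).lTensor (Module.Dual ℂ W) (f ⊗ₜ (g ⊗ₜ h)))).1 =
          -(wedgeTensor g f h + wedgeTensor h f g) := by
        refine ext fun u v w => ?_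
        rw [hookMap_apply, tensorDualEquiv_incl_symmetrize, tensorDualEquiv_incl_symmetrize,
          ← neg_one_smul ℂ, smul_apply, add_apply, wedgeTensor_apply, wedgeTensor_apply]
        simp only [tensorDualEquiv_tmul]
        ring
      rw [heq]
      exact M.neg_mem (hpol g f h)
  have h := key t
  rwa [ht] at h

/-- The space of hook forms is irreducible under the unitary group, also over the reals. -/
theorem hookForms_le_of_unitary_invariant_real {R : Submodule ℝ (TrilinearForm W)}
    (hR : ∀ B ∈ R, B ∈ hookForms W)
    (hinv : ∀ g : W →ₗ[ℂ] W, (∀ u v, ⟪g u, g v⟫ = ⟪u, v⟫) → ∀ B ∈ R, pullback B g ∈ R)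
    (hne : R ≠ ⊥) : ∀ B ∈ hookForms W, B ∈ R := by
  have hI : ∀ B ∈ R, Complex.I • B ∈ R := by
    intro B hB
    -- The scalar `-i` is unitary and acts on trilinear forms by `(-i)³ = i`, so `R` is a complex
    -- subspace.
    have h := hinv ((-Complex.I) • LinearMap.id) (fun u v => by
      simp only [LinearMap.smul_apply, LinearMap.id_apply, inner_smul_left, inner_smul_right,
        map_neg, Complex.conj_I]
      linear_combination (-⟪u, v⟫) * Complex.I_sq) B hB
    have heq : pullback B ((-Complex.I) • LinearMap.id) = Complex.I • B := by
      refine ext fun u v w => ?_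
      simp only [pullback_apply, LinearMap.smul_apply, LinearMap.id_apply, eval_smul₁, eval_smul₂,
        eval_smul₃, smul_apply]
      linear_combination (-Complex.I * B u v w) * Complex.I_sq
    rwa [heq] at h
  let M : Submodule ℂ (TrilinearForm W) :=
    { R with
      smul_mem' := fun c B hB => by
        have h : c • B = c.re • B + c.im • (Complex.I • B) := by
          rw [← Complex.coe_smul, ← Complex.coe_smul, smul_smul, ← add_smul, Complex.re_add_im]
        rw [h]
        exact R.add_mem (R.smul_mem _ hB) (R.smul_mem _ (hI B hB)) }
  refine hookForms_le_of_unitary_invariant (M := M) hR hinv fun h => hne ?_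
  rw [Submodule.eq_bot_iff] at h ⊢
  exact h

end Hermitian

end TrilinearForm

/-! ### Non-vanishing of hook forms and irreducibility under `GL(W)`. -/

section HookRepresentation

variable {W : Type*} [AddCommGroup W] [Module ℂ W]

open TrilinearForm

/-- A space of hook forms invariant under the isometries of a Hermitian inner product is zero or
everything. -/
theorem hookForms_le_of_core_invariant [FiniteDimensional ℂ W] (cd : InnerProductSpace.Core ℂ W)
    {R : Submodule ℝ (TrilinearForm W)} (hR : ∀ B ∈ R, B ∈ hookForms W)
    (hinv : ∀ g : W →ₗ[ℂ] W, (∀ u v, cd.inner (g u) (g v) = cd.inner u v) →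
      ∀ B ∈ R, pullback B g ∈ R)
    (hne : R ≠ ⊥) : ∀ B ∈ hookForms W, B ∈ R :=
  letI : NormedAddCommGroup W := cd.toNormedAddCommGroup
  letI : InnerProductSpace ℂ W := InnerProductSpace.ofCore cd.toCore
  hookForms_le_of_unitary_invariant_real hR hinv hne

theorem wedgeTensor_mem_hookForms (f g : Module.Dual ℂ W) : wedgeTensor f g f ∈ hookForms W := by
  refine ⟨fun x y z => ?_, fun x y z => ?_⟩ <;> simp only [wedgeTensor_apply] <;> ring

theorem exists_ne_zero_mem_hookForms [FiniteDimensional ℂ W] (h : 2 ≤ Module.finrank ℂ W) :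
    ∃ B ∈ hookForms W, B ≠ 0 := by
  let b := Module.finBasis ℂ W
  let i : Fin (Module.finrank ℂ W) := ⟨0, by omega⟩
  let k : Fin (Module.finrank ℂ W) := ⟨1, by omega⟩
  have hik : i ≠ k := by simp [i, k]
  refine ⟨wedgeTensor (b.coord i) (b.coord k) (b.coord i), wedgeTensor_mem_hookForms _ _,
    fun h0 => ?_⟩
  have h1 : wedgeTensor (b.coord i) (b.coord k) (b.coord i) (b i) (b k) (b i) = 0 := by
    rw [h0, TrilinearForm.zero_apply]
  rw [wedgeTensor_apply] at h1
  simp [hik, hik.symm] at h1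

/-- On a space of dimension at most 1, any form alternating in two arguments vanishes. -/
theorem hookForms_eq_bot (h : Module.finrank ℂ W ≤ 1) [FiniteDimensional ℂ W] :
    hookForms W = ⊥ := by
  obtain ⟨v, hv⟩ := finrank_le_one_iff.1 h
  refine (Submodule.eq_bot_iff _).2 fun B hB => TrilinearForm.ext fun x y z => ?_
  obtain ⟨a, rfl⟩ := hv x
  obtain ⟨b, rfl⟩ := hv y
  rw [eval_smul₁, eval_smul₂, TrilinearForm.zero_apply]
  linear_combination (a * b / 2) * hB.1 v v z

/-- `(W* ⊗ S²W*) / S³W*` is an irreducible representation of `GL(W)`. -/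
theorem dualHookRep_isIrreducible [FiniteDimensional ℂ W] (cd : InnerProductSpace.Core ℂ W)
    (h : 2 ≤ Module.finrank ℂ W) : (dualHookRep W).IsIrreducible := by
  have hnt : Nontrivial (Subrepresentation (dualHookRep W)) := by
    obtain ⟨B, hB, hB0⟩ := exists_ne_zero_mem_hookForms h
    refine ⟨⊥, ⊤, fun hbt => hB0 ?_⟩
    have hmem : hookEquiv.symm ⟨B, hB⟩ ∈ (⊤ : Subrepresentation (dualHookRep W)).toSubmodule :=
      Submodule.mem_top
    rw [← hbt] at hmem
    have h0 : hookEquiv.symm ⟨B, hB⟩ = 0 := (Submodule.mem_bot ℂ).1 hmem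
    rw [LinearEquiv.map_eq_zero_iff] at h0
    exact congrArg Subtype.val h0
  refine { hnt with eq_bot_or_eq_top := fun σ => ?_ }
  let ψ : ((Module.Dual ℂ W ⊗[ℂ] symTwo (Module.Dual ℂ W)) ⧸ symThree (Module.Dual ℂ W)) →ₗ[ℂ]
      TrilinearForm W := (hookForms W).subtype ∘ₗ hookEquiv.toLinearMap
  have hψ : Function.Injective ψ := Subtype.val_injective.comp hookEquiv.injective
  let M : Submodule ℂ (TrilinearForm W) := σ.toSubmodule.map ψ
  by_cases hM : M = ⊥
  · left
    apply Subrepresentation.toSubmodule_injective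
    exact (Submodule.map_injective_of_injective hψ) (hM.trans (Submodule.map_bot ψ).symm)
  · right
    apply Subrepresentation.toSubmodule_injective
    have hall := hookForms_le_of_core_invariant cd (R := M.restrictScalars ℝ) ?_ ?_ ?_
    · refine (Submodule.eq_top_iff'.2 fun q => ?_ : σ.toSubmodule = ⊤)
      obtain ⟨q', hq', hqq⟩ := hall _ (hookEquiv q).2
      rwa [← hψ hqq]
    · rintro _ ⟨q, -, rfl⟩
      exact (hookEquiv q).2
    · rintro g hg _ ⟨q, hq, rfl⟩
      have hginj : Function.Injective g := by
        rw [injective_iff_map_eq_zero]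
        intro u hu
        apply cd.definite
        rw [← hg u u, hu]
        simpa using cd.smul_left (0 : W) 0 0
      let g' : W ≃ₗ[ℂ] W := LinearEquiv.ofInjectiveEndo g hginj
      -- The group acts by pullback along the inverse, so pullback by `g` is the action of `g'⁻¹`.
      refine ⟨dualHookRep W g'⁻¹ q, σ.apply_mem_toSubmodule _ hq, TrilinearForm.ext fun x y z => ?_⟩
      change (hookEquiv (dualHookRep W g'⁻¹ q)).1 x y z = (hookEquiv q).1 (g x) (g y) (g z)
      rw [hookEquiv_dualHookRep, inv_inv]
      rfl
    · rw [Ne, Submodule.restrictScalars_eq_bot_iff]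
      exact hM

end HookRepresentation

/-! ### Nijenhuis tensors as hook forms. -/

section NijenhuisForms

open TrilinearForm

variable {V : Type*} [AddCommGroup V] [Module ℝ V] {Ω : LinearMap.BilinForm ℝ V} {j : V →ₗ[ℝ] V}

theorem IsPositiveCompatible.apply_j_left (hj : IsPositiveCompatible Ω j)
    (hΩ : IsSymplecticForm Ω) (X Y : V) : Ω (j X) Y = -Ω X (j Y) := by
  have h := hΩ.alt (j X + Y)
  have hs := hj.symm X Y
  simp only [map_add, LinearMap.add_apply, hΩ.alt] at h
  linear_combination h + hs

theorem IsSymplecticForm.apply_swap (hΩ : IsSymplecticForm Ω) (X Y : V) : Ω X Y = -Ω Y X := by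
  have h := hΩ.alt (X + Y)
  simp only [map_add, LinearMap.add_apply, hΩ.alt] at h
  linear_combination h

/-- The Hermitian inner product `Ω(X, jY) + i Ω(X, Y)`. -/
@[reducible]
def hermitianCore (hΩ : IsSymplecticForm Ω) (hj : IsPositiveCompatible Ω j) :
    InnerProductSpace.Core ℂ (ComplexSpace j hj.sq) where
  inner := fun (X Y : V) => ⟨Ω X (j Y), Ω X Y⟩
  conj_inner_symm := fun (X Y : V) => by
    apply Complex.ext
    · exact hj.symm Y X
    · change -Ω Y X = Ω X Y
      rw [hΩ.apply_swap X Y]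
  re_inner_nonneg := fun (X : V) => by
    change 0 ≤ Ω X (j X)
    by_cases h : X = 0
    · rw [h, map_zero, map_zero, LinearMap.zero_apply]
    · exact (hj.pos X h).le
  add_left := fun (X Y Z : V) => by
    apply Complex.ext
    · change Ω (X + Y) (j Z) = Ω X (j Z) + Ω Y (j Z)
      rw [map_add, LinearMap.add_apply]
    · change Ω (X + Y) Z = Ω X Z + Ω Y Z
      rw [map_add, LinearMap.add_apply]
  smul_left := fun (X Y : V) (c : ℂ) => by
    apply Complex.ext
    · change Ω (c.re • X + c.im • j X) (j Y) = c.re * Ω X (j Y) - (-c.im) * Ω X Y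
      rw [map_add, LinearMap.add_apply, map_smul, map_smul, LinearMap.smul_apply,
        LinearMap.smul_apply, hj.apply_j_left hΩ, hj.sq, map_neg, smul_eq_mul, smul_eq_mul]
      ring
    · change Ω (c.re • X + c.im • j X) Y = c.re * Ω X Y + (-c.im) * Ω X (j Y)
      rw [map_add, LinearMap.add_apply, map_smul, map_smul, LinearMap.smul_apply,
        LinearMap.smul_apply, hj.apply_j_left hΩ, smul_eq_mul, smul_eq_mul]
      ring
  definite := fun (X : V) h => by
    by_contra hX
    exact (hj.pos X hX).ne' (congrArg Complex.re h)

/-- The identity as a real linear map from `V` to the complex space `W`. -/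
def toComplexSpace (j : V →ₗ[ℝ] V) (hj : ∀ X, j (j X) = -X) : V ≃ₗ[ℝ] ComplexSpace j hj where
  toFun X := X
  invFun X := X
  left_inv _ := rfl
  right_inv _ := rfl
  map_add' _ _ := rfl
  map_smul' := fun (r : ℝ) (X : V) => by
    change r • X = (r : ℂ).re • X + (r : ℂ).im • j X
    rw [Complex.ofReal_re, Complex.ofReal_im, zero_smul, add_zero]

theorem finrank_complexSpace (hj : ∀ X, j (j X) = -X) :
    2 * Module.finrank ℂ (ComplexSpace j hj) = Module.finrank ℝ V := by
  rw [← finrank_real_of_complex, (toComplexSpace j hj).finrank_eq]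

theorem finiteDimensional_complexSpace [FiniteDimensional ℝ V] (hj : ∀ X, j (j X) = -X) :
    FiniteDimensional ℂ (ComplexSpace j hj) :=
  have : Module.Finite ℝ (ComplexSpace j hj) := Module.Finite.equiv (toComplexSpace j hj)
  Module.Finite.of_restrictScalars_finite ℝ ℂ (ComplexSpace j hj)

/-- The complex linear form `Z ↦ Ω(v, Z) - i Ω(v, jZ)`. -/
def complexDual (Ω : LinearMap.BilinForm ℝ V) (hj : ∀ X, j (j X) = -X) (v : V) :
    Module.Dual ℂ (ComplexSpace j hj) where
  toFun := fun (Z : V) => ⟨Ω v Z, -Ω v (j Z)⟩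
  map_add' := fun (Y Z : V) => by
    apply Complex.ext
    · exact map_add (Ω v) Y Z
    · change -Ω v (j (Y + Z)) = -Ω v (j Y) + -Ω v (j Z)
      rw [map_add, map_add, neg_add]
  map_smul' := fun (c : ℂ) (Z : V) => by
    apply Complex.ext
    · change Ω v (c.re • Z + c.im • j Z) = c.re * Ω v Z - c.im * -Ω v (j Z)
      rw [map_add, map_smul, map_smul, smul_eq_mul, smul_eq_mul]
      ring
    · change -Ω v (j (c.re • Z + c.im • j Z)) = c.re * -Ω v (j Z) + c.im * Ω v Z
      rw [map_add, map_smul, map_smul, map_add, map_smul, map_smul, hj, map_neg, smul_eq_mul,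
        smul_eq_mul]
      ring

section

variable (hsq : ∀ X, j (j X) = -X)

theorem complexDual_add (v w : V) :
    complexDual Ω hsq (v + w) = complexDual Ω hsq v + complexDual Ω hsq w := by
  refine LinearMap.ext fun (Z : V) => Complex.ext ?_ ?_
  · exact LinearMap.congr_fun (map_add Ω v w) Z
  · change -Ω (v + w) (j Z) = -Ω v (j Z) + -Ω w (j Z)
    rw [map_add, LinearMap.add_apply, neg_add]

theorem complexDual_smul (r : ℝ) (v : V) :
    complexDual Ω hsq (r • v) = (r : ℂ) • complexDual Ω hsq v := by
  refine LinearMap.ext fun (Z : V) => Complex.ext ?_ ?_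
  · change Ω (r • v) Z = r * Ω v Z - 0 * -Ω v (j Z)
    rw [map_smul, LinearMap.smul_apply, smul_eq_mul]
    ring
  · change -Ω (r • v) (j Z) = r * -Ω v (j Z) + 0 * Ω v Z
    rw [map_smul, LinearMap.smul_apply, smul_eq_mul]
    ring

end

/-- The identification of `V` with `W*` through `Ω` is conjugate linear. This is why `i` corresponds
to `T ↦ -j ∘ T`, and it compensates the conjugate linearity of `T` in its arguments. -/
theorem complexDual_neg_j (hΩ : IsSymplecticForm Ω) (hj : IsPositiveCompatible Ω j) (v : V) :
    complexDual Ω hj.sq (-j v) = Complex.I • complexDual Ω hj.sq v := by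
  refine LinearMap.ext fun (Z : V) => Complex.ext ?_ ?_
  · change Ω (-j v) Z = 0 * Ω v Z - 1 * -Ω v (j Z)
    rw [map_neg, LinearMap.neg_apply, hj.apply_j_left hΩ]
    ring
  · change -Ω (-j v) (j Z) = 0 * -Ω v (j Z) + 1 * Ω v Z
    rw [map_neg, LinearMap.neg_apply, hj.apply_j_left hΩ, hj.sq, map_neg]
    ring

theorem complexDual_smul_sub_j (hΩ : IsSymplecticForm Ω) (hj : IsPositiveCompatible Ω j) (c : ℂ)
    (v : V) : complexDual Ω hj.sq (c.re • v + c.im • -j v) = c • complexDual Ω hj.sq v := by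
  rw [complexDual_add, complexDual_smul, complexDual_smul, complexDual_neg_j hΩ hj, smul_smul,
    ← add_smul, Complex.re_add_im]

/-- The trilinear form `Ω(T(X, Y), Z) - i Ω(T(X, Y), jZ)`. -/
def nijenhuisForm (hΩ : IsSymplecticForm Ω) (hj : IsPositiveCompatible Ω j)
    (T : nijenhuisSpace Ω j) : TrilinearForm (ComplexSpace j hj.sq) :=
  TrilinearForm.lin.symm
    { toFun := fun (X : V) =>
        { toFun := fun (Y : V) => complexDual Ω hj.sq (T.1 X Y)
          map_add' := fun (Y Z : V) => by
            rw [← complexDual_add, ← map_add]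
            rfl
          map_smul' := fun (c : ℂ) (Y : V) => by
            have hT : T.1 X (j Y) = -j (T.1 X Y) := by
              rw [T.2.1, T.2.2.1, T.2.1 X Y, map_neg]
            rw [RingHom.id_apply, ← complexDual_smul_sub_j hΩ hj, ← hT, ← map_smul, ← map_smul,
              ← map_add]
            rfl }
      map_add' := fun (X X' : V) => LinearMap.ext fun (Y : V) => by
        change complexDual Ω hj.sq (T.1 (X + X') Y) =
          complexDual Ω hj.sq (T.1 X Y) + complexDual Ω hj.sq (T.1 X' Y)
        rw [← complexDual_add, map_add, LinearMap.add_apply]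
      map_smul' := fun (c : ℂ) (X : V) => LinearMap.ext fun (Y : V) => by
        change complexDual Ω hj.sq (T.1 (c.re • X + c.im • j X) Y) =
          c • complexDual Ω hj.sq (T.1 X Y)
        rw [← complexDual_smul_sub_j hΩ hj, ← T.2.2.1, map_add, map_smul, map_smul]
        rfl }

theorem nijenhuisForm_apply (hΩ : IsSymplecticForm Ω) (hj : IsPositiveCompatible Ω j)
    (T : nijenhuisSpace Ω j) (X Y Z : V) :
    nijenhuisForm hΩ hj T X Y Z = complexDual Ω hj.sq (T.1 X Y) Z := rfl

theorem nijenhuisForm_mem (hΩ : IsSymplecticForm Ω) (hj : IsPositiveCompatible Ω j)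
    (T : nijenhuisSpace Ω j) : nijenhuisForm hΩ hj T ∈ hookForms (ComplexSpace j hj.sq) := by
  have hT : ∀ X Y Z : V, Ω (T.1 X Y) (j Z) = Ω (T.1 (j X) Y) Z := fun X Y Z => by
    rw [T.2.2.1, map_neg, LinearMap.neg_apply, hj.apply_j_left hΩ, neg_neg]
  have hT' : ∀ X Y Z : V, Ω (T.1 X Y) (j Z) = Ω (T.1 X (j Y)) Z := fun X Y Z => by
    rw [T.2.1 X (j Y), map_neg, LinearMap.neg_apply, ← hT, T.2.1 X Y, map_neg,
      LinearMap.neg_apply]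
  refine ⟨fun (X Y Z : V) => ?_, fun (X Y Z : V) => ?_⟩
  · rw [nijenhuisForm_apply, nijenhuisForm_apply, T.2.1 X Y]
    apply Complex.ext
    · change Ω (-T.1 Y X) Z = -Ω (T.1 Y X) Z
      rw [map_neg, LinearMap.neg_apply]
    · change -Ω (-T.1 Y X) (j Z) = - -Ω (T.1 Y X) (j Z)
      rw [map_neg, LinearMap.neg_apply]
  · rw [nijenhuisForm_apply, nijenhuisForm_apply, nijenhuisForm_apply]
    apply Complex.ext
    · exact T.2.2.2 X Y Z
    · change -Ω (T.1 X Y) (j Z) + -Ω (T.1 Y Z) (j X) + -Ω (T.1 Z X) (j Y) = 0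
      -- Moving `j` onto `X` in the first and third terms turns the imaginary part into the cyclic
      -- identity for `(jX, Y, Z)`.
      rw [hT X Y Z, hT' Z X Y]
      linear_combination -T.2.2.2 (j X) Y Z

/-- The map `nijenhuisForm` as a real linear map. -/
def nijenhuisFormHom (hΩ : IsSymplecticForm Ω) (hj : IsPositiveCompatible Ω j) :
    nijenhuisSpace Ω j →ₗ[ℝ] hookForms (ComplexSpace j hj.sq) where
  toFun T := ⟨nijenhuisForm hΩ hj T, nijenhuisForm_mem hΩ hj T⟩
  map_add' S T := Subtype.ext <| TrilinearForm.ext fun (X Y Z : V) => by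
    change complexDual Ω hj.sq (S.1 X Y + T.1 X Y) Z =
      complexDual Ω hj.sq (S.1 X Y) Z + complexDual Ω hj.sq (T.1 X Y) Z
    rw [complexDual_add]
    rfl
  map_smul' r T := Subtype.ext <| TrilinearForm.ext fun (X Y Z : V) => by
    change complexDual Ω hj.sq (r • T.1 X Y) Z = (r : ℂ) * complexDual Ω hj.sq (T.1 X Y) Z
    rw [complexDual_smul]
    rfl

theorem nijenhuisFormHom_injective (hΩ : IsSymplecticForm Ω) (hj : IsPositiveCompatible Ω j) :
    Function.Injective (nijenhuisFormHom hΩ hj) := by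
  rw [injective_iff_map_eq_zero]
  intro T hT
  refine Subtype.ext (LinearMap.ext fun X => LinearMap.ext fun Y => ?_)
  change T.1 X Y = 0
  by_contra h
  have h0 : nijenhuisForm hΩ hj T = 0 := congrArg Subtype.val hT
  -- The real part at this third argument is `g(T(X,Y), T(X,Y))`, which positivity forbids from
  -- vanishing.
  have h1 : nijenhuisForm hΩ hj T X Y (j (T.1 X Y)) = 0 := by rw [h0]; rfl
  exact (hj.pos _ h).ne' (congrArg Complex.re h1)

/-- The real part of a complex linear form. -/
def realPartDual (hsq : ∀ X, j (j X) = -X) :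
    Module.Dual ℂ (ComplexSpace j hsq) →ₗ[ℝ] Module.Dual ℝ V where
  toFun f := Complex.reLm ∘ₗ f.restrictScalars ℝ ∘ₗ (toComplexSpace j hsq).toLinearMap
  map_add' _ _ := rfl
  map_smul' r f := by
    ext Z
    change ((r : ℂ) * f Z).re = r * (f Z).re
    rw [Complex.re_ofReal_mul]

theorem nijenhuisFormHom_surjective [FiniteDimensional ℝ V] (hΩ : IsSymplecticForm Ω)
    (hj : IsPositiveCompatible Ω j) : Function.Surjective (nijenhuisFormHom hΩ hj) := by
  rintro ⟨B, hB⟩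
  let θ := toComplexSpace j hj.sq
  let D := LinearMap.BilinForm.toDual Ω hΩ.nondegenerate
  -- `T` is the tensor with `Ω(T(X,Y), Z) = Re B(X,Y,Z)`. The imaginary part then agrees
  -- automatically, since a complex linear `f` satisfies `Im f(Z) = -Re f(iZ)`.
  let T : V →ₗ[ℝ] V →ₗ[ℝ] V := LinearMap.mk₂ ℝ
    (fun X Y => D.symm (realPartDual hj.sq (lin B (θ X) (θ Y))))
    (fun X X' Y => by simp only [map_add, LinearMap.add_apply])
    (fun r X Y => by
      rw [map_smul, ← Complex.coe_smul, map_smul, LinearMap.smul_apply, Complex.coe_smul,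
        map_smul, map_smul])
    (fun X Y Y' => by simp only [map_add])
    (fun r X Y => by
      rw [map_smul, ← Complex.coe_smul, map_smul, Complex.coe_smul, map_smul, map_smul])
  have hT : ∀ X Y Z, Ω (T X Y) Z = (B (θ X) (θ Y) (θ Z)).re := fun X Y Z =>
    LinearMap.BilinForm.apply_toDual_symm_apply (hB := hΩ.nondegenerate) _ _
  have hθ : ∀ X, θ (j X) = Complex.I • θ X := fun X => by
    change j X = (Complex.I.re • X + Complex.I.im • j X : V)
    rw [Complex.I_re, Complex.I_im, zero_smul, one_smul, zero_add]
  have hext : ∀ v w : V, (∀ Z, Ω v Z = Ω w Z) → v = w := fun v w h =>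
    D.injective (LinearMap.ext h)
  have hmem : T ∈ nijenhuisSpace Ω j := by
    refine ⟨fun X Y => hext _ _ fun Z => ?_, fun X Y => hext _ _ fun Z => ?_, fun X Y Z => ?_⟩
    · rw [map_neg, LinearMap.neg_apply, hT, hT, hB.1, Complex.neg_re]
    · rw [map_neg, LinearMap.neg_apply, hj.apply_j_left hΩ, neg_neg, hT, hT, hθ, hθ, eval_smul₁,
        eval_smul₃]
    · rw [hT, hT, hT, ← Complex.add_re, ← Complex.add_re, hB.2, Complex.zero_re]
  refine ⟨⟨T, hmem⟩, Subtype.ext (TrilinearForm.ext fun (X Y Z : V) => Complex.ext ?_ ?_)⟩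
  · exact hT X Y Z
  · change -Ω (T X Y) (j Z) = (B (θ X) (θ Y) (θ Z)).im
    rw [hT, hθ, eval_smul₃, Complex.I_mul_re, neg_neg]

theorem nijenhuisForm_nijenhuisRep (hΩ : IsSymplecticForm Ω) (hj : IsPositiveCompatible Ω j)
    (g : linearUnitaryGroup Ω j) (T : nijenhuisSpace Ω j) (X Y Z : V) :
    nijenhuisForm hΩ hj (nijenhuisRep Ω j g T) X Y Z =
      nijenhuisForm hΩ hj T (g.1⁻¹ X) (g.1⁻¹ Y) (g.1⁻¹ Z) := by
  have h : ∀ v Z : V, Ω (g.1 v) Z = Ω v (g.1⁻¹ Z) := fun v Z => by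
    rw [← g.2.1 v, ← LinearEquiv.mul_apply, mul_inv_cancel]
    rfl
  apply Complex.ext
  · exact h _ _
  · change -Ω (g.1 (T.1 (g.1⁻¹ X) (g.1⁻¹ Y))) (j Z) = -Ω (T.1 (g.1⁻¹ X) (g.1⁻¹ Y)) (j (g.1⁻¹ Z))
    have hgj : g.1⁻¹ (j Z) = j (g.1⁻¹ Z) := (g⁻¹).2.2 Z
    rw [h, hgj]

/-- A complex linear isometry is an element of the unitary group. -/
theorem exists_unitary_eq [FiniteDimensional ℝ V] (hΩ : IsSymplecticForm Ω)
    (hj : IsPositiveCompatible Ω j)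
    (g : ComplexSpace j hj.sq →ₗ[ℂ] ComplexSpace j hj.sq)
    (hg : ∀ u v, (hermitianCore hΩ hj).inner (g u) (g v) = (hermitianCore hΩ hj).inner u v) :
    ∃ g' : linearUnitaryGroup Ω j, ∀ X : V, g'.1 X = g X := by
  let θ := toComplexSpace j hj.sq
  let f : V →ₗ[ℝ] V := θ.symm.toLinearMap ∘ₗ g.restrictScalars ℝ ∘ₗ θ.toLinearMap
  -- The imaginary part of the Hermitian product is `Ω`, and its real part is the metric, whose
  -- positivity gives injectivity below.
  have hf : ∀ X Y, Ω (f X) (f Y) = Ω X Y := fun X Y => congrArg Complex.im (hg X Y)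
  have hfre : ∀ X, Ω (f X) (j (f X)) = Ω X (j X) := fun X => congrArg Complex.re (hg X X)
  have hfj : ∀ X, f (j X) = j (f X) := fun X => by
    have h : g (Complex.I.re • X + Complex.I.im • j X : V) =
        (Complex.I.re • f X + Complex.I.im • j (f X) : V) := g.map_smul Complex.I X
    rw [Complex.I_re, Complex.I_im, zero_smul, one_smul, zero_add, zero_smul, one_smul,
      zero_add] at h
    exact h
  have hinj : Function.Injective f := by
    rw [injective_iff_map_eq_zero]
    intro X hX
    by_contra h
    have hpos := hj.pos X h
    rw [← hfre, hX, map_zero, LinearMap.zero_apply] at hpos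
    exact hpos.false
  exact ⟨⟨LinearEquiv.ofInjectiveEndo f hinj, hf, hfj⟩, fun _ => rfl⟩

theorem nijenhuisRep_isIrreducible [FiniteDimensional ℝ V] (hΩ : IsSymplecticForm Ω)
    (hj : IsPositiveCompatible Ω j) (h : 2 ≤ Module.finrank ℂ (ComplexSpace j hj.sq)) :
    Representation.IsIrreducible (k := ℝ) (V := nijenhuisSpace Ω j) (nijenhuisRep Ω j) := by
  have := finiteDimensional_complexSpace hj.sq
  let ψ : nijenhuisSpace Ω j →ₗ[ℝ] TrilinearForm (ComplexSpace j hj.sq) :=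
    (hookForms (ComplexSpace j hj.sq)).subtype.restrictScalars ℝ ∘ₗ nijenhuisFormHom hΩ hj
  have hψ : Function.Injective ψ :=
    Subtype.val_injective.comp (nijenhuisFormHom_injective hΩ hj)
  have hnt : Nontrivial (Subrepresentation (nijenhuisRep Ω j)) := by
    obtain ⟨B, hB, hB0⟩ := exists_ne_zero_mem_hookForms h
    obtain ⟨T, hT⟩ := nijenhuisFormHom_surjective hΩ hj ⟨B, hB⟩
    refine ⟨⊥, ⊤, fun hbt => hB0 ?_⟩
    have hmem : T ∈ (⊤ : Subrepresentation (nijenhuisRep Ω j)).toSubmodule := Submodule.mem_top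
    rw [← hbt] at hmem
    have h0 : T = 0 := (Submodule.mem_bot ℝ).1 hmem
    rw [h0, map_zero] at hT
    exact (congrArg Subtype.val hT).symm
  refine { hnt with eq_bot_or_eq_top := fun σ => ?_ }
  by_cases hM : σ.toSubmodule.map ψ = ⊥
  · left
    apply Subrepresentation.toSubmodule_injective
    exact (Submodule.map_injective_of_injective hψ) (hM.trans (Submodule.map_bot ψ).symm)
  · right
    apply Subrepresentation.toSubmodule_injective
    have hall := hookForms_le_of_core_invariant (hermitianCore hΩ hj) (R := σ.toSubmodule.map ψ)
      ?_ ?_ hM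
    · refine (Submodule.eq_top_iff'.2 fun T => ?_ : σ.toSubmodule = ⊤)
      obtain ⟨T', hT', hTT⟩ := hall _ (nijenhuisForm_mem hΩ hj T)
      have hTT' : ψ T' = ψ T := hTT
      rwa [← hψ hTT']
    · rintro _ ⟨T, -, rfl⟩
      exact nijenhuisForm_mem hΩ hj T
    · rintro g hg _ ⟨T, hT, rfl⟩
      obtain ⟨g', hg'⟩ := exists_unitary_eq hΩ hj g hg
      refine ⟨nijenhuisRep Ω j g'⁻¹ T, σ.apply_mem_toSubmodule _ hT,
        TrilinearForm.ext fun (X Y Z : V) => ?_⟩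
      refine (nijenhuisForm_nijenhuisRep hΩ hj g'⁻¹ T X Y Z).trans ?_
      have hinv : (g'⁻¹).1⁻¹ = g'.1 := inv_inv g'.1
      rw [hinv, hg', hg', hg']
      rfl

end NijenhuisForms

/-! ### The main theorem. -/

theorem mainTheorem1 {V : Type*} [AddCommGroup V] [Module ℝ V] [FiniteDimensional ℝ V]
    (n : ℕ) (hdim : Module.finrank ℝ V = 2 * n)
    (Ω : LinearMap.BilinForm ℝ V) (hΩ : IsSymplecticForm Ω)
    (j : V →ₗ[ℝ] V) (hj : IsPositiveCompatible Ω j) :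
    (2 ≤ n →
      Representation.IsIrreducible (k := ℝ) (V := nijenhuisSpace Ω j) (nijenhuisRep Ω j) ∧
      (dualHookRep (ComplexSpace j hj.sq)).IsIrreducible) ∧
    (n ≤ 1 → nijenhuisSpace Ω j = ⊥) ∧
    ∃ e : nijenhuisSpace Ω j ≃ₗ[ℝ]
        ((Module.Dual ℂ (ComplexSpace j hj.sq) ⊗[ℂ]
          symTwo (Module.Dual ℂ (ComplexSpace j hj.sq))) ⧸
            symThree (Module.Dual ℂ (ComplexSpace j hj.sq))),
      (∀ (g : linearUnitaryGroup Ω j) (T : nijenhuisSpace Ω j),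
        e (nijenhuisRep Ω j g T) =
          dualHookRep (ComplexSpace j hj.sq) (unitaryToGL Ω j hj.sq g) (e T)) ∧
      ∀ S T : nijenhuisSpace Ω j, (∀ X Y, S.1 X Y = -j (T.1 X Y)) →
        e S = Complex.I • e T := by
  have := finiteDimensional_complexSpace hj.sq
  have hn : Module.finrank ℂ (ComplexSpace j hj.sq) = n := by
    have h := finrank_complexSpace hj.sq
    omega
  refine ⟨fun h => ⟨nijenhuisRep_isIrreducible hΩ hj (hn ▸ h),
    dualHookRep_isIrreducible (hermitianCore hΩ hj) (hn ▸ h)⟩, fun h => ?_, ?_⟩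
  · refine (Submodule.eq_bot_iff _).2 fun T hT => ?_
    have hmem := nijenhuisForm_mem hΩ hj ⟨T, hT⟩
    rw [hookForms_eq_bot (hn.trans_le h), Submodule.mem_bot] at hmem
    have h0 : (⟨T, hT⟩ : nijenhuisSpace Ω j) = 0 :=
      nijenhuisFormHom_injective hΩ hj (Subtype.ext (hmem.trans (by rw [map_zero]; rfl)))
    exact congrArg Subtype.val h0
  -- The isomorphism passes through hook forms, where the actions on both sides become pullback by
  -- `g⁻¹`.
  · let N := LinearEquiv.ofBijective (nijenhuisFormHom hΩ hj)
      ⟨nijenhuisFormHom_injective hΩ hj, nijenhuisFormHom_surjective hΩ hj⟩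
    let H := hookEquiv (W := ComplexSpace j hj.sq)
    have hval : ∀ T, H (H.symm (N T)) = N T := fun T => H.apply_symm_apply _
    refine ⟨N ≪≫ₗ H.symm.restrictScalars ℝ, fun g T => ?_, fun S T hST => ?_⟩
    · change H.symm (N (nijenhuisRep Ω j g T)) = dualHookRep _ _ (H.symm (N T))
      apply H.injective
      rw [hval]
      refine Subtype.ext (TrilinearForm.ext fun (X Y Z : V) => ?_)
      refine (nijenhuisForm_nijenhuisRep hΩ hj g T X Y Z).trans ?_
      refine Eq.trans ?_ (hookEquiv_dualHookRep (unitaryToGL Ω j hj.sq g) (H.symm (N T)) X Y Z).symm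
      exact congrArg (fun B => B.1 (g.1⁻¹ X) (g.1⁻¹ Y) (g.1⁻¹ Z)) (hval T).symm
    · change H.symm (N S) = Complex.I • H.symm (N T)
      rw [← map_smul]
      congr 1
      refine Subtype.ext (TrilinearForm.ext fun (X Y Z : V) => ?_)
      change complexDual Ω hj.sq (S.1 X Y) Z = (Complex.I • complexDual Ω hj.sq (T.1 X Y)) Z
      rw [hST, complexDual_neg_j hΩ hj]

end
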